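/- **Setting.** Let $n\in\mathbb Z_+$. A *statistical query* is a (measurable) function $f:\mathbb R^n\to[-1,1]$ asked with a tolerance $\tau>0$; a STAT oracle for a distribution $D$ on $\mathbb R^n$ answers it with some value $a$ such that $|a-\mathbf E_{X\sim D}[f(X)]|\le\tau$. An *SQ algorithm* is a (possibly randomized) procedure that adaptively asks statistical queries, sees only the answers, stops after finitely many queries, and outputs a verdict $H_0$ or $H_1$; there is no computational restriction. For $\alpha\in(0,1/2)$, $\rho>0$ and $k\in\mathbb Z_+$ consider the testing problem - $H_0$: the underlying distribution is $\mathcal N(0,I_n)$; - $H_1$: the underlying distribution is $\alpha\,\mathcal N(\rho v,I_n)+(1-\alpha)B$ for some unknown unit vector $v\in\mathbb R^n$ with at most $k$ non-zero coordinates and some unknown, arbitrary probability distribution $B$ on $\mathbb R^n$. The algorithm *solves* the problem if, for every distribution of $H_0$ or $H_1$ and every STAT oracle for it that is a function of the query and its tolerance, its verdict is wrong with probability at most $1/3$ over its internal randomness. **Theorem 4.5 (Statistical Query Lower Bound).** There are absolute constants $C_1,C_2,C_3>0$ such that the following holds for every $t\in\mathbb Z_+$ and every sufficiently small constant $c>0$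 (that is, for all $0<c\le c_0$, where $c_0>0$ depends only on $t$). Let $k,n\in\mathbb Z_+$ with $k\le\sqrt n$, let $\alpha\in(0,1/2)$, and let $\rho=c\,(t\alpha)^{-1/t}$. Then every SQ algorithm that solves the testing problem above does one of the following, for some distribution of $H_0$ or $H_1$ and some STAT oracle for it, with positive probability over its internal randomness: - it uses at least one query of tolerance at most $C_1\,2^{t/2}\,k^{-(t+1)/4}\exp\!\big(C_2\,(t\alpha)^{-2/t}\big)$, or - it makes at least $C_3\,n^{\sqrt k/16}\,k^{-(t+1)/2}$ queries. -/

import Mathlib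

open MeasureTheory ProbabilityTheory

/-- A statistical query on `ℝⁿ`: a (measurable) function with values in `[-1, 1]`, asked
together with a tolerance `tol > 0`. -/
structure StatQuery (n : ℕ) where
  toFun : EuclideanSpace ℝ (Fin n) → ℝ
  measurable_toFun : Measurable toFun
  mem_Icc : ∀ x, toFun x ∈ Set.Icc (-1 : ℝ) 1
  tol : ℝ
  tol_pos : 0 < tol

/-- `O` is a `STAT` oracle for the distribution `D`: the answer to each query is within the
tolerance of that query from its expectation under `D`. -/
def IsStatOracle {n : ℕ} (D : Measure (EuclideanSpace ℝ (Fin n))) (O : StatQuery n → ℝ) : Prop :=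
  ∀ q : StatQuery n, |O q - ∫ x, q.toFun x ∂D| ≤ q.tol

/-- A deterministic adaptive SQ algorithm for a testing problem, as a decision tree: it either
stops with a verdict (`false` for the null hypothesis, `true` for the alternative), or
asks a query and goes on depending on the answer. There is no computational restriction. -/
inductive SQAlgorithm (n : ℕ) : Type
  | output (verdict : Bool) : SQAlgorithm n
  | ask (q : StatQuery n) (next : ℝ → SQAlgorithm n) : SQAlgorithm n

namespace SQAlgorithm

/-- The verdict of the algorithm when its queries are answered by `O`. -/
def verdict {n : ℕ} (O : StatQuery n → ℝ) : SQAlgorithm n → Bool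
  | output b => b
  | ask q next => verdict O (next (O q))

/-- The list of the queries that the algorithm makes when they are answered by `O`. -/
def queries {n : ℕ} (O : StatQuery n → ℝ) : SQAlgorithm n → List (StatQuery n)
  | output _ => []
  | ask q next => q :: queries O (next (O q))

end SQAlgorithm

/-- A vector is `k`-sparse if it has at most `k` non-zero coordinates. -/
def IsSparse {n : ℕ} (k : ℕ) (v : EuclideanSpace ℝ (Fin n)) : Prop :=
  {i : Fin n | v i ≠ 0}.ncard ≤ k

/-- The null hypothesis `N(0, Iₙ)`. -/
noncomputable def nullDist (n : ℕ) : Measure (EuclideanSpace ℝ (Fin n)) :=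
  multivariateGaussian 0 1

/-- The mixture `α N(ρ v, Iₙ) + (1 - α) B`. -/
noncomputable def mixtureDist {n : ℕ} (α ρ : ℝ) (v : EuclideanSpace ℝ (Fin n))
    (B : Measure (EuclideanSpace ℝ (Fin n))) : Measure (EuclideanSpace ℝ (Fin n)) :=
  ENNReal.ofReal α • multivariateGaussian (ρ • v) 1 + ENNReal.ofReal (1 - α) • B

/-- The alternative hypothesis: all mixtures `α N(ρ v, Iₙ) + (1 - α) B` with `v` a `k`-sparse unit
vector and `B` an arbitrary probability distribution. -/
def altDists (n k : ℕ) (α ρ : ℝ) : Set (Measure (EuclideanSpace ℝ (Fin n))) :=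
  {D | ∃ (v : EuclideanSpace ℝ (Fin n)) (B : Measure (EuclideanSpace ℝ (Fin n))),
    ‖v‖ = 1 ∧ IsSparse k v ∧ IsProbabilityMeasure B ∧ D = mixtureDist α ρ v B}

/-- The randomized SQ algorithm that draws a seed `ω` from `P` and runs `A ω` solves the testing
problem: against every `STAT` oracle of every distribution of either hypothesis, its verdict is
wrong with probability at most `1/3` over the seed (in the sense of outer measure). -/
def SolvesTesting {Ω : Type*} [MeasurableSpace Ω] {n : ℕ} (k : ℕ) (α ρ : ℝ) (P : Measure Ω)
    (A : Ω → SQAlgorithm n) : Prop :=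
  (∀ O : StatQuery n → ℝ, IsStatOracle (nullDist n) O →
    P {ω | (A ω).verdict O ≠ false} ≤ 1 / 3) ∧
  ∀ D ∈ altDists n k α ρ, ∀ O : StatQuery n → ℝ, IsStatOracle D O →
    P {ω | (A ω).verdict O ≠ true} ≤ 1 / 3

/-! The hard alternatives hide the shift in a Gaussian-like noise. For a unit vector `v`, take `B`
with density `1 + r ⟪v, x⟫ / (1 - α)` relative to the standard Gaussian, so that the mixture has
relative density `1 + ψ ⟪v, x⟫` with `ψ x = α (exp (ρ x - ρ² / 2) - 1) + r x`. The correction `r` is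
bounded by `1 / 2` and cancels all Hermite coefficients of `ψ` up to degree `t`
(`exists_moment_matching`). By Mehler's formula (`hasSum_integral_hermiteSignal_mul`) the
correlation of the signals along `v` and `u` is then at most `|⟪v, u⟫| ^ (t + 1)` times `∫ ψ²`,
which is at most `β = 3 exp (ρ²)`.

A Reed–Solomon code gives at least `n ^ (√k / 16)` sparse unit vectors with pairwise inner products
at most `2 / √k` (`exists_sparse_family`), hence pairwise correlations at most `γ = (2 / √k) ^ (t +
1) β`. By Cauchy–Schwarz, a query whose tolerance has square at least `2 γ` separates the null from
at most `2 β / γ` of these alternatives (`card_filter_lt_abs_integral_le`).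

Against every other alternative an oracle may answer as under the null. A correct algorithm must
therefore, averaged over its seed, separate at least a third of the family while running on exact
null answers (`card_div_three_le_of_solves`), which takes many queries. -/

open scoped RealInnerProductSpace

/-! ### Gaussian integrals of complex exponentials -/

section GaussianExponentials

lemma integrable_cexp_gaussianReal (z : ℂ) :
    Integrable (fun x : ℝ => Complex.exp (z * x)) (gaussianReal 0 1) := by
  have h := integrable_cexp_mul_of_re_mem_integrableExpSet (X := id) (μ := gaussianReal 0 1)
    (z := z) aemeasurable_id (by simp [integrableExpSet_id_gaussianReal])
  simpa using h

lemma integral_cexp_gaussianReal (z : ℂ) :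
    ∫ x : ℝ, Complex.exp (z * x) ∂(gaussianReal 0 1) = Complex.exp (z ^ 2 / 2) := by
  have h := complexMGF_id_gaussianReal (μ := 0) (v := 1) z
  simpa [complexMGF] using h

variable {n : ℕ}

lemma cexp_sum_stdGaussian (ζ : Fin n → ℂ) :
    Integrable (fun x : EuclideanSpace ℝ (Fin n) => Complex.exp (∑ i, ζ i * x i))
        (stdGaussian (EuclideanSpace ℝ (Fin n))) ∧
      ∫ x, Complex.exp (∑ i, ζ i * x i) ∂(stdGaussian (EuclideanSpace ℝ (Fin n))) =
        Complex.exp (∑ i, ζ i ^ 2 / 2) := by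
  rw [← map_pi_eq_stdGaussian]
  have hm : AEMeasurable (WithLp.toLp 2 : (Fin n → ℝ) → EuclideanSpace ℝ (Fin n))
      (Measure.pi (fun _ => gaussianReal 0 1)) := by fun_prop
  have hs : AEStronglyMeasurable (fun x : EuclideanSpace ℝ (Fin n) =>
      Complex.exp (∑ i, ζ i * x i))
      ((Measure.pi (fun _ => gaussianReal 0 1)).map (WithLp.toLp 2)) := by
    apply Continuous.aestronglyMeasurable
    fun_prop
  constructor
  · rw [integrable_map_measure hs hm]
    simp only [Function.comp_def, Complex.exp_sum]
    exact Integrable.fintype_prod (f := fun i (x : ℝ) => Complex.exp (ζ i * x))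
      fun i => integrable_cexp_gaussianReal _
  · rw [integral_map hm hs]
    simp only [Complex.exp_sum]
    rw [integral_fintype_prod_eq_prod (f := fun i (x : ℝ) => Complex.exp (ζ i * x))]
    simp only [integral_cexp_gaussianReal]

lemma ofReal_inner_eq_sum (v x : EuclideanSpace ℝ (Fin n)) :
    ((⟪v, x⟫ : ℝ) : ℂ) = ∑ i, (v i : ℂ) * x i := by
  rw [PiLp.inner_apply]
  push_cast
  exact Finset.sum_congr rfl fun i _ => by simp [mul_comm]

lemma cexp_inner_add_inner_stdGaussian (v u : EuclideanSpace ℝ (Fin n)) (z w : ℂ) :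
    Integrable (fun x => Complex.exp (z * (⟪v, x⟫ : ℝ) + w * (⟪u, x⟫ : ℝ)))
        (stdGaussian (EuclideanSpace ℝ (Fin n))) ∧
      ∫ x, Complex.exp (z * (⟪v, x⟫ : ℝ) + w * (⟪u, x⟫ : ℝ))
          ∂(stdGaussian (EuclideanSpace ℝ (Fin n))) =
        Complex.exp (z ^ 2 * (⟪v, v⟫ : ℝ) / 2 + w ^ 2 * (⟪u, u⟫ : ℝ) / 2 +
          z * w * (⟪v, u⟫ : ℝ)) := by
  have h : ∀ x : EuclideanSpace ℝ (Fin n), z * (⟪v, x⟫ : ℝ) + w * (⟪u, x⟫ : ℝ) =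
      ∑ i, (z * v i + w * u i) * x i := fun x => by
    simp only [ofReal_inner_eq_sum, Finset.mul_sum, ← Finset.sum_add_distrib]
    exact Finset.sum_congr rfl fun i _ => by ring
  have h2 : z ^ 2 * (⟪v, v⟫ : ℝ) / 2 + w ^ 2 * (⟪u, u⟫ : ℝ) / 2 + z * w * (⟪v, u⟫ : ℝ) =
      ∑ i, (z * v i + w * u i) ^ 2 / 2 := by
    simp only [ofReal_inner_eq_sum, Finset.mul_sum, Finset.sum_div, ← Finset.sum_add_distrib]
    exact Finset.sum_congr rfl fun i _ => by ring
  simp only [h, h2]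
  exact cexp_sum_stdGaussian _

/-- The generating function `exp (z x - z² / 2)` of the Hermite polynomials. -/
noncomputable def hermiteExp (z : ℂ) (x : ℝ) : ℂ := Complex.exp (z * x - z ^ 2 / 2)

@[fun_prop]
lemma continuous_hermiteExp (z : ℂ) : Continuous (hermiteExp z) := by
  unfold hermiteExp; fun_prop

lemma hermiteExp_ofReal (ρ x : ℝ) : hermiteExp ρ x = (Real.exp (ρ * x - ρ ^ 2 / 2) : ℝ) := by
  simp [hermiteExp]

lemma hermiteExp_zero (x : ℝ) : hermiteExp 0 x = 1 := by simp [hermiteExp]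

lemma hermiteExp_conj (z : ℂ) (x : ℝ) :
    hermiteExp (starRingEnd ℂ z) x = starRingEnd ℂ (hermiteExp z x) := by
  simp [hermiteExp, ← Complex.exp_conj, map_ofNat]

/-- Imaginary nodes give functions bounded in `x`; the correction `r` is built from them so that a
small multiple keeps the noise density nonnegative. -/
lemma norm_hermiteExp_mul_I (a x : ℝ) :
    ‖hermiteExp (a * Complex.I) x‖ = Real.exp (a ^ 2 / 2) := by
  have : (a * Complex.I) * x - (a * Complex.I) ^ 2 / 2 =
      ((a ^ 2 / 2 : ℝ) : ℂ) + ((a * x : ℝ) : ℂ) * Complex.I := by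
    push_cast
    rw [mul_pow, Complex.I_sq]
    ring
  rw [hermiteExp, this, Complex.exp_add, norm_mul, Complex.norm_exp_ofReal_mul_I, mul_one,
    ← Complex.ofReal_exp, Complex.norm_real, Real.norm_of_nonneg (Real.exp_pos _).le]

variable {v u : EuclideanSpace ℝ (Fin n)}

/-- For unit vectors the normalizing factors cancel the diagonal terms of the Gaussian exponent,
leaving only the cross term. This is Mehler's formula in generating-function form. -/
lemma hermiteExp_mul_hermiteExp (hv : ‖v‖ = 1) (hu : ‖u‖ = 1) (z w : ℂ) :
    Integrable (fun x => hermiteExp z ⟪v, x⟫ * hermiteExp w ⟪u, x⟫)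
        (stdGaussian (EuclideanSpace ℝ (Fin n))) ∧
      ∫ x, hermiteExp z ⟪v, x⟫ * hermiteExp w ⟪u, x⟫
          ∂(stdGaussian (EuclideanSpace ℝ (Fin n))) =
        Complex.exp ((⟪v, u⟫ : ℝ) * (z * w)) := by
  have h : ∀ x : EuclideanSpace ℝ (Fin n), hermiteExp z ⟪v, x⟫ * hermiteExp w ⟪u, x⟫ =
      Complex.exp (-(z ^ 2 / 2 + w ^ 2 / 2)) *
        Complex.exp (z * (⟪v, x⟫ : ℝ) + w * (⟪u, x⟫ : ℝ)) := fun x => by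
    simp only [hermiteExp, ← Complex.exp_add]
    congr 1
    ring
  obtain ⟨h1, h2⟩ := cexp_inner_add_inner_stdGaussian v u z w
  simp only [h]
  refine ⟨h1.const_mul _, ?_⟩
  rw [integral_const_mul, h2, ← Complex.exp_add]
  simp only [real_inner_self_eq_norm_sq, hv, hu]
  congr 1
  push_cast
  ring

lemma integrable_hermiteExp (hv : ‖v‖ = 1) (z : ℂ) :
    Integrable (fun x => hermiteExp z ⟪v, x⟫) (stdGaussian (EuclideanSpace ℝ (Fin n))) := by
  simpa [hermiteExp_zero] using (hermiteExp_mul_hermiteExp hv hv z 0).1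

lemma integral_hermiteExp (hv : ‖v‖ = 1) (z : ℂ) :
    ∫ x, hermiteExp z ⟪v, x⟫ ∂(stdGaussian (EuclideanSpace ℝ (Fin n))) = 1 := by
  simpa [hermiteExp_zero] using (hermiteExp_mul_hermiteExp hv hv z 0).2

lemma integrable_exp_inner (hv : ‖v‖ = 1) (ρ : ℝ) :
    Integrable (fun x => Real.exp (ρ * ⟪v, x⟫ - ρ ^ 2 / 2))
      (stdGaussian (EuclideanSpace ℝ (Fin n))) := by
  have h := (integrable_hermiteExp hv ρ).re
  simpa [hermiteExp_ofReal, -Complex.ofReal_exp, -Complex.ofReal_sub] using h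

/-- The Cameron–Martin formula for the standard Gaussian. -/
lemma multivariateGaussian_smul_one (hv : ‖v‖ = 1) (ρ : ℝ) :
    multivariateGaussian (ρ • v) 1 =
      (stdGaussian (EuclideanSpace ℝ (Fin n))).withDensity
        fun x => ENNReal.ofReal (Real.exp (ρ * ⟪v, x⟫ - ρ ^ 2 / 2)) := by
  have hfin : IsFiniteMeasure ((stdGaussian (EuclideanSpace ℝ (Fin n))).withDensity
        fun x => ENNReal.ofReal (Real.exp (ρ * ⟪v, x⟫ - ρ ^ 2 / 2))) :=
    isFiniteMeasure_withDensity_ofReal (integrable_exp_inner hv ρ).2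
  apply Measure.ext_of_charFun
  ext y
  rw [charFun_multivariateGaussian Matrix.PosSemidef.one, charFun_apply,
    integral_withDensity_eq_integral_toReal_smul (by fun_prop) (by simp)]
  have h : ∀ x : EuclideanSpace ℝ (Fin n),
      (ENNReal.ofReal (Real.exp (ρ * ⟪v, x⟫ - ρ ^ 2 / 2))).toReal •
        Complex.exp ((⟪x, y⟫ : ℝ) * Complex.I) =
      Complex.exp (-(ρ ^ 2 / 2)) *
        Complex.exp (ρ * (⟪v, x⟫ : ℝ) + Complex.I * (⟪y, x⟫ : ℝ)) := fun x => by
    rw [ENNReal.toReal_ofReal (Real.exp_pos _).le, Complex.real_smul, Complex.ofReal_exp,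
      ← Complex.exp_add, ← Complex.exp_add, real_inner_comm y x]
    congr 1
    push_cast
    ring
  simp only [h]
  rw [integral_const_mul, (cexp_inner_add_inner_stdGaussian v y ρ Complex.I).2, ← Complex.exp_add]
  congr 1
  simp only [real_inner_self_eq_norm_sq, hv, Complex.I_sq]
  rw [real_inner_smul_right, real_inner_comm]
  simp [EuclideanSpace.real_norm_sq_eq, dotProduct, ← sq]
  ring

end GaussianExponentials

/-! ### Hermite expansions and Mehler's formula -/

section Signals

variable {ι : Type*} [Fintype ι] {n : ℕ}

/-- The real part of a linear combination of the functions `hermiteExp (z i)`. -/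
noncomputable def hermiteSignal (c z : ι → ℂ) (x : ℝ) : ℝ := (∑ i, c i * hermiteExp (z i) x).re

/-- The `j`-th Hermite coefficient (up to normalization) of `hermiteSignal c z`. -/
noncomputable def hermiteMoment (c z : ι → ℂ) (j : ℕ) : ℝ := (∑ i, c i * z i ^ j).re

lemma continuous_hermiteSignal (c z : ι → ℂ) : Continuous (hermiteSignal c z) := by
  unfold hermiteSignal
  fun_prop

/-- The coefficients of `hermiteSignal c z` without the real part. -/
noncomputable def conjCoeff (c : ι → ℂ) : ι ⊕ ι → ℂ :=
  Sum.elim (fun i => c i / 2) (fun i => starRingEnd ℂ (c i) / 2)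

/-- The nodes of `hermiteSignal c z` without the real part. -/
noncomputable def conjNode (z : ι → ℂ) : ι ⊕ ι → ℂ :=
  Sum.elim z (fun i => starRingEnd ℂ (z i))

/-- A product of real parts is not bilinear over `ℂ`. Averaging with the conjugate, at the price of
doubling the index set, makes products expand into double sums. -/
lemma ofReal_hermiteSignal (c z : ι → ℂ) (x : ℝ) :
    (hermiteSignal c z x : ℂ) = ∑ p, conjCoeff c p * hermiteExp (conjNode z p) x := by
  simp only [hermiteSignal, Complex.re_eq_add_conj, Fintype.sum_sum_type, conjCoeff, conjNode,
    Sum.elim_inl, Sum.elim_inr, hermiteExp_conj, map_sum, map_mul, add_div, Finset.sum_div]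
  congr 1 <;> exact Finset.sum_congr rfl fun i _ => by ring

lemma ofReal_hermiteMoment (c z : ι → ℂ) (j : ℕ) :
    (hermiteMoment c z j : ℂ) = ∑ p, conjCoeff c p * conjNode z p ^ j := by
  simp only [hermiteMoment, Complex.re_eq_add_conj, Fintype.sum_sum_type, conjCoeff, conjNode,
    Sum.elim_inl, Sum.elim_inr, map_sum, map_mul, map_pow, add_div, Finset.sum_div]
  congr 1 <;> exact Finset.sum_congr rfl fun i _ => by ring

variable {v u : EuclideanSpace ℝ (Fin n)}

lemma ofReal_hermiteSignal_mul (c z : ι → ℂ) (x y : ℝ) :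
    ((hermiteSignal c z x * hermiteSignal c z y : ℝ) : ℂ) =
      ∑ p, ∑ q, conjCoeff c p * conjCoeff c q *
        (hermiteExp (conjNode z p) x * hermiteExp (conjNode z q) y) := by
  rw [Complex.ofReal_mul, ofReal_hermiteSignal, ofReal_hermiteSignal, Finset.sum_mul_sum]
  exact Finset.sum_congr rfl fun p _ => Finset.sum_congr rfl fun q _ => by ring

lemma integrable_hermiteSignal_mul (hv : ‖v‖ = 1) (hu : ‖u‖ = 1) (c z : ι → ℂ) :
    Integrable (fun x => hermiteSignal c z ⟪v, x⟫ * hermiteSignal c z ⟪u, x⟫)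
      (stdGaussian (EuclideanSpace ℝ (Fin n))) := by
  have h : Integrable (fun x => ∑ p, ∑ q, conjCoeff c p * conjCoeff c q *
      (hermiteExp (conjNode z p) ⟪v, x⟫ * hermiteExp (conjNode z q) ⟪u, x⟫))
      (stdGaussian (EuclideanSpace ℝ (Fin n))) :=
    integrable_finsetSum _ fun p _ => integrable_finsetSum _ fun q _ =>
      (hermiteExp_mul_hermiteExp hv hu _ _).1.const_mul _
  simp only [← ofReal_hermiteSignal_mul] at h
  exact h.re

lemma ofReal_integral_hermiteSignal_mul (hv : ‖v‖ = 1) (hu : ‖u‖ = 1) (c z : ι → ℂ) :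
    ((∫ x, hermiteSignal c z ⟪v, x⟫ * hermiteSignal c z ⟪u, x⟫
        ∂(stdGaussian (EuclideanSpace ℝ (Fin n))) : ℝ) : ℂ) =
      ∑ p, ∑ q, conjCoeff c p * conjCoeff c q *
        Complex.exp ((⟪v, u⟫ : ℝ) * (conjNode z p * conjNode z q)) := by
  rw [← integral_complex_ofReal]
  simp only [ofReal_hermiteSignal_mul]
  rw [integral_finsetSum _ fun p _ => integrable_finsetSum _ fun q _ =>
      (hermiteExp_mul_hermiteExp hv hu _ _).1.const_mul _]
  refine Finset.sum_congr rfl fun p _ => ?_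
  rw [integral_finsetSum _ fun q _ => (hermiteExp_mul_hermiteExp hv hu _ _).1.const_mul _]
  refine Finset.sum_congr rfl fun q _ => ?_
  rw [integral_const_mul, (hermiteExp_mul_hermiteExp hv hu _ _).2]

lemma ofReal_pow_mul_hermiteMoment_sq (c z : ι → ℂ) (s : ℝ) (j : ℕ) :
    ((s ^ j * (hermiteMoment c z j ^ 2 / j.factorial) : ℝ) : ℂ) =
      ∑ p, ∑ q, conjCoeff c p * conjCoeff c q *
        ((s * (conjNode z p * conjNode z q)) ^ j / j.factorial) := by
  push_cast
  rw [ofReal_hermiteMoment, sq, Finset.sum_mul_sum, Finset.sum_div, Finset.mul_sum]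
  refine Finset.sum_congr rfl fun p _ => ?_
  rw [Finset.sum_div, Finset.mul_sum]
  refine Finset.sum_congr rfl fun q _ => ?_
  rw [mul_pow, mul_pow]
  ring

lemma hasSum_cexp (w : ℂ) : HasSum (fun j : ℕ => w ^ j / j.factorial) (Complex.exp w) := by
  rw [Complex.exp_eq_exp_ℂ]
  exact NormedSpace.expSeries_div_hasSum_exp w

/-- Mehler's formula for linear combinations of the functions `hermiteExp (z i)`. -/
lemma hasSum_integral_hermiteSignal_mul (hv : ‖v‖ = 1) (hu : ‖u‖ = 1) (c z : ι → ℂ) :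
    HasSum (fun j : ℕ => ⟪v, u⟫ ^ j * (hermiteMoment c z j ^ 2 / j.factorial))
      (∫ x, hermiteSignal c z ⟪v, x⟫ * hermiteSignal c z ⟪u, x⟫
        ∂(stdGaussian (EuclideanSpace ℝ (Fin n)))) := by
  rw [← Complex.hasSum_ofReal, ofReal_integral_hermiteSignal_mul hv hu]
  simp only [ofReal_pow_mul_hermiteMoment_sq]
  exact hasSum_sum fun p _ => hasSum_sum fun q _ => (hasSum_cexp _).mul_left _

/-- Termwise comparison of the Mehler series for `(v, u)` and `(v, v)`: terms up to degree `t`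
vanish, and `|⟪v, u⟫| ≤ 1` bounds the later powers by the power `t + 1`. -/
lemma abs_integral_hermiteSignal_mul_le (hv : ‖v‖ = 1) (hu : ‖u‖ = 1) {c z : ι → ℂ} {t : ℕ}
    (hm : ∀ j ≤ t, hermiteMoment c z j = 0) :
    |∫ x, hermiteSignal c z ⟪v, x⟫ * hermiteSignal c z ⟪u, x⟫
        ∂(stdGaussian (EuclideanSpace ℝ (Fin n)))| ≤
      |⟪v, u⟫| ^ (t + 1) * ∫ x, hermiteSignal c z ⟪v, x⟫ * hermiteSignal c z ⟪v, x⟫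
        ∂(stdGaussian (EuclideanSpace ℝ (Fin n))) := by
  have h1 := hasSum_integral_hermiteSignal_mul hv hu c z
  have h2 := (hasSum_integral_hermiteSignal_mul hv hv c z).mul_left (|⟪v, u⟫| ^ (t + 1))
  refine h1.norm_le_of_bounded h2 fun j => ?_
  have hs : |⟪v, u⟫| ≤ 1 := by simpa [hv, hu] using abs_real_inner_le_norm v u
  rw [real_inner_self_eq_norm_sq, hv, Real.norm_eq_abs, abs_mul, abs_pow,
    abs_of_nonneg (by positivity : 0 ≤ hermiteMoment c z j ^ 2 / j.factorial)]
  rcases le_or_gt j t with hj | hj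
  · simp [hm j hj]
  · simp only [one_pow, one_mul]
    exact mul_le_mul_of_nonneg_right (pow_le_pow_of_le_one (abs_nonneg _) hs hj) (by positivity)

end Signals

/-! ### Cancelling the first `t` Hermite moments -/

section MomentMatching

/-- Solving for prescribed moments with nodes `0, i, …, t i`, with a bound on the solution. -/
lemma exists_vandermonde_bound (t : ℕ) : ∃ K > (0 : ℝ), ∀ (b : Fin (t + 1) → ℂ) (M : ℝ),
    (∀ j, ‖b j‖ ≤ M) → ∃ d : Fin (t + 1) → ℂ,
      (∀ j : Fin (t + 1), ∑ k : Fin (t + 1), d k * ((k : ℝ) * Complex.I) ^ (j : ℕ) = b j) ∧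
      ∀ k, ‖d k‖ ≤ K * M := by
  set V : Matrix (Fin (t + 1)) (Fin (t + 1)) ℂ :=
    Matrix.vandermonde fun k : Fin (t + 1) => ((k : ℝ) : ℂ) * Complex.I with hV
  have hdet : IsUnit V.det := by
    rw [isUnit_iff_ne_zero, hV, Matrix.det_vandermonde_ne_zero_iff]
    intro a b hab
    simpa [Fin.val_inj] using hab
  refine ⟨1 + ∑ j, ∑ k, ‖V⁻¹ j k‖, by positivity, fun b M hb => ⟨Matrix.vecMul b V⁻¹, ?_, ?_⟩⟩
  · intro j
    have h : Matrix.vecMul (Matrix.vecMul b V⁻¹) V = b := by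
      rw [Matrix.vecMul_vecMul, Matrix.nonsing_inv_mul _ hdet, Matrix.vecMul_one]
    exact congrFun h j
  · intro k
    have hM : 0 ≤ M := (norm_nonneg _).trans (hb 0)
    calc ‖Matrix.vecMul b V⁻¹ k‖ = ‖∑ j, b j * V⁻¹ j k‖ := rfl
      _ ≤ ∑ j, ‖b j * V⁻¹ j k‖ := norm_sum_le _ _
      _ ≤ ∑ j, ‖V⁻¹ j k‖ * M := Finset.sum_le_sum fun j _ => by
          rw [norm_mul, mul_comm]
          exact mul_le_mul_of_nonneg_left (hb j) (norm_nonneg _)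
      _ = (∑ j, ‖V⁻¹ j k‖) * M := by rw [Finset.sum_mul]
      _ ≤ (1 + ∑ j, ∑ k, ‖V⁻¹ j k‖) * M := by
          refine mul_le_mul_of_nonneg_right ?_ hM
          have : ∑ j, ‖V⁻¹ j k‖ ≤ ∑ j, ∑ k, ‖V⁻¹ j k‖ := Finset.sum_le_sum fun j _ =>
            Finset.single_le_sum (f := fun k => ‖V⁻¹ j k‖) (fun _ _ => norm_nonneg _)
              (Finset.mem_univ k)
          linarith

/-- Bounds the moments `α ρ ^ j` to be cancelled, uniformly in `α`; this is where the scaling of `ρ`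
enters. If `t α ≤ 1`, the worst exponent is `j = t`, giving `1 / t`; otherwise the negative power of
`t α` is at most `1`. -/
lemma mul_pow_rpow_le {t j : ℕ} {c α : ℝ} (hj : 1 ≤ j) (hjt : j ≤ t) (hc : 0 < c) (hc1 : c ≤ 1)
    (hα : 0 < α) (hα1 : α ≤ 1) :
    α * (c * ((t : ℝ) * α) ^ (-(1 / (t : ℝ)))) ^ j ≤ c := by
  have ht : (1 : ℝ) ≤ t := by exact_mod_cast hj.trans hjt
  have htα : 0 < (t : ℝ) * α := by positivity
  have hcj : c ^ j ≤ c := by simpa using pow_le_pow_of_le_one hc.le hc1 hj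
  have hα2 : α * ((t : ℝ) * α) ^ (-(1 / (t : ℝ)) * j) ≤ 1 := by
    rcases le_total ((t : ℝ) * α) 1 with h | h
    · have h1 : ((t : ℝ) * α) ^ (-(1 / (t : ℝ)) * j) ≤ ((t : ℝ) * α) ^ (-1 : ℝ) := by
        apply Real.rpow_le_rpow_of_exponent_ge htα h
        have : (j : ℝ) / t ≤ 1 := by
          rw [div_le_one (by positivity)]
          exact_mod_cast hjt
        rw [show -(1 / (t : ℝ)) * j = -((j : ℝ) / t) by ring]
        linarith
      calc _ ≤ α * ((t : ℝ) * α) ^ (-1 : ℝ) := mul_le_mul_of_nonneg_left h1 hα.le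
        _ = 1 / t := by
            rw [Real.rpow_neg_one]
            field_simp
        _ ≤ 1 := by rw [div_le_one (by positivity)]; exact ht
    · have h1 : ((t : ℝ) * α) ^ (-(1 / (t : ℝ)) * j) ≤ 1 := by
        apply Real.rpow_le_one_of_one_le_of_nonpos h
        have : 0 ≤ 1 / (t : ℝ) * j := by positivity
        linarith
      nlinarith
  rw [mul_pow, ← Real.rpow_mul_natCast htα.le]
  calc _ = c ^ j * (α * ((t : ℝ) * α) ^ (-(1 / (t : ℝ)) * j)) := by ring
    _ ≤ c ^ j * 1 := mul_le_mul_of_nonneg_left hα2 (by positivity)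
    _ ≤ c := by linarith

/-- A bounded perturbation `r` of the density that makes the first `t` moments of the mixture
`α N(ρ, 1) + (1 - α) N(0, 1) + r` agree with those of `N(0, 1)`; the correlations of the resulting
relative densities along two directions decay accordingly. -/
lemma exists_moment_matching (t : ℕ) : ∃ c₀ > (0 : ℝ), c₀ ≤ 1 ∧
    ∀ c α : ℝ, 0 < c → c ≤ c₀ → 0 < α → α ≤ 1 → ∃ r : ℝ → ℝ, Continuous r ∧ (∀ x, |r x| ≤ 1 / 2) ∧
      ∀ ρ : ℝ, ρ = c * ((t : ℝ) * α) ^ (-(1 / (t : ℝ))) →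
      ∀ ψ : ℝ → ℝ, (∀ x, ψ x = α * (Real.exp (ρ * x - ρ ^ 2 / 2) - 1) + r x) →
      ∀ (n : ℕ) (v : EuclideanSpace ℝ (Fin n)), ‖v‖ = 1 →
        ∫ x, r ⟪v, x⟫ ∂(stdGaussian (EuclideanSpace ℝ (Fin n))) = 0 ∧
        ∀ u : EuclideanSpace ℝ (Fin n), ‖u‖ = 1 →
          Integrable (fun x => ψ ⟪v, x⟫ * ψ ⟪u, x⟫) (stdGaussian (EuclideanSpace ℝ (Fin n))) ∧
          |∫ x, ψ ⟪v, x⟫ * ψ ⟪u, x⟫ ∂(stdGaussian (EuclideanSpace ℝ (Fin n)))| ≤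
            |⟪v, u⟫| ^ (t + 1) *
              ∫ x, ψ ⟪v, x⟫ * ψ ⟪v, x⟫ ∂(stdGaussian (EuclideanSpace ℝ (Fin n))) := by
  obtain ⟨K, hK, hsolve⟩ := exists_vandermonde_bound t
  set S : ℝ := ∑ k : Fin (t + 1), Real.exp ((k : ℝ) ^ 2 / 2) with hS
  have hS0 : 0 < S := Finset.sum_pos (fun _ _ => Real.exp_pos _) Finset.univ_nonempty
  -- The coefficients of `r` are at most `K c` and its exponentials have norms summing to `S`, so
  -- `|r| ≤ K c S`; the threshold makes this at most `1 / 2` and depends on `t` alone.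
  refine ⟨min 1 (1 / (2 * (K * S))), by positivity, min_le_left _ _, ?_⟩
  intro c α hc hcc hα hα1
  have hc1 : c ≤ 1 := hcc.trans (min_le_left _ _)
  have hc2 : c * (2 * (K * S)) ≤ 1 := by
    rw [← le_div_iff₀ (by positivity)]
    exact hcc.trans (min_le_right _ _)
  obtain ⟨ρ₀, hρ₀⟩ : ∃ ρ₀ : ℝ, ρ₀ = c * ((t : ℝ) * α) ^ (-(1 / (t : ℝ))) := ⟨_, rfl⟩
  have hρ₀0 : 0 ≤ ρ₀ := by rw [hρ₀]; positivity
  obtain ⟨d, hd, hdK⟩ := hsolve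
    (fun j => if (j : ℕ) = 0 then 0 else -((α * ρ₀ ^ (j : ℕ) : ℝ) : ℂ)) c (by
      intro j
      split_ifs with h
      · simpa using hc.le
      · rw [norm_neg, Complex.norm_real, Real.norm_of_nonneg (by positivity), hρ₀]
        exact mul_pow_rpow_le (Nat.one_le_iff_ne_zero.2 h) (Nat.lt_succ_iff.1 j.2) hc hc1 hα hα1)
  set w : Fin (t + 1) → ℂ := fun k => ((k : ℝ) : ℂ) * Complex.I with hw
  refine ⟨hermiteSignal d w, continuous_hermiteSignal _ _, ?_, ?_⟩
  · intro x
    calc |hermiteSignal d w x| ≤ ‖∑ k, d k * hermiteExp (w k) x‖ := Complex.abs_re_le_norm _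
      _ ≤ ∑ k, ‖d k * hermiteExp (w k) x‖ := norm_sum_le _ _
      _ ≤ ∑ k : Fin (t + 1), K * c * Real.exp ((k : ℝ) ^ 2 / 2) := Finset.sum_le_sum fun k _ => by
          rw [norm_mul, hw, norm_hermiteExp_mul_I]
          exact mul_le_mul_of_nonneg_right (hdK k) (Real.exp_pos _).le
      _ = c * (2 * (K * S)) / 2 := by rw [← Finset.mul_sum]; ring
      _ ≤ 1 / 2 := by linarith
  · intro ρ hρ ψ hψ n v hv
    obtain rfl : ρ = ρ₀ := hρ.trans hρ₀.symm
    -- The signal has nodes `ρ` (weight `α`), `0` (weight `-α`, the constant term) and those of `r`.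
    -- The first two cancel in degree `0`, so there `r` needs moment `0`, that is, mean zero.
    set c' : Option (Option (Fin (t + 1))) → ℂ :=
      fun o => o.elim (α : ℂ) fun o => o.elim (-(α : ℂ)) d with hc'
    set z' : Option (Option (Fin (t + 1))) → ℂ :=
      fun o => o.elim (ρ : ℂ) fun o => o.elim 0 w with hz'
    have hψ' : ψ = hermiteSignal c' z' := by
      funext x
      rw [hψ]
      simp only [hermiteSignal, Fintype.sum_option, hc', hz', Option.elim, hermiteExp_ofReal,
        hermiteExp_zero, ← Complex.ofReal_mul, Complex.add_re, Complex.ofReal_re,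
        Complex.neg_re, mul_one]
      ring
    have hm : ∀ j ≤ t, hermiteMoment c' z' j = 0 := by
      intro j hj
      have h := hd ⟨j, Nat.lt_succ_iff.2 hj⟩
      simp only [hermiteMoment, Fintype.sum_option, hc', hz', Option.elim]
      change (_ + (_ + ∑ k : Fin (t + 1), d k * (((k : ℝ) : ℂ) * Complex.I) ^ j)).re = 0
      rw [h]
      rcases Nat.eq_zero_or_pos j with rfl | hj0
      · simp
      · simp only [hj0.ne', if_false, zero_pow hj0.ne']
        simp
    refine ⟨?_, fun u hu => ?_⟩
    · have h1 : Integrable (fun x => ∑ k, d k * hermiteExp (w k) ⟪v, x⟫)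
          (stdGaussian (EuclideanSpace ℝ (Fin n))) :=
        integrable_finsetSum _ fun k _ => (integrable_hermiteExp hv _).const_mul _
      have h2 : ∫ x, (∑ k, d k * hermiteExp (w k) ⟪v, x⟫)
          ∂(stdGaussian (EuclideanSpace ℝ (Fin n))) = 0 := by
        rw [integral_finsetSum _ fun k _ => (integrable_hermiteExp hv _).const_mul _]
        simp only [integral_const_mul, integral_hermiteExp hv, mul_one]
        simpa using hd 0
      have h3 := integral_re h1
      simp only [h2] at h3
      simpa [hermiteSignal] using h3
    · rw [hψ']
      exact ⟨integrable_hermiteSignal_mul hv hu _ _, abs_integral_hermiteSignal_mul_le hv hu hm⟩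

end MomentMatching

/-! ### The alternatives with a hidden direction -/

section HiddenDirection

variable {n : ℕ}

/-- The factor `1 - α` cancels in the noise density, so the mixture has relative density `1 + ψ`.
Since `|r| ≤ 1 / 2 < 1 - α`, `ENNReal.ofReal` truncates nothing. -/
lemma integral_mixtureDist {α ρ : ℝ} {r : ℝ → ℝ} (hα : 0 < α) (hα2 : α < 1 / 2)
    (hr : Continuous r) (hr2 : ∀ x, |r x| ≤ 1 / 2) {v : EuclideanSpace ℝ (Fin n)} (hv : ‖v‖ = 1)
    {f : EuclideanSpace ℝ (Fin n) → ℝ} (hf : Measurable f) (hf1 : ∀ x, f x ∈ Set.Icc (-1 : ℝ) 1) :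
    ∫ x, f x ∂(mixtureDist α ρ v ((stdGaussian (EuclideanSpace ℝ (Fin n))).withDensity
        fun x => ENNReal.ofReal (1 + r ⟪v, x⟫ / (1 - α)))) =
      ∫ x, f x ∂(stdGaussian (EuclideanSpace ℝ (Fin n))) +
        ∫ x, f x * (α * (Real.exp (ρ * ⟪v, x⟫ - ρ ^ 2 / 2) - 1) + r ⟪v, x⟫)
          ∂(stdGaussian (EuclideanSpace ℝ (Fin n))) := by
  have hfb : ∀ x, ‖f x‖ ≤ 1 := fun x => abs_le.2 (hf1 x)
  have hα1 : 0 < 1 - α := by linarith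
  have hpos : ∀ x, 0 ≤ 1 + r x / (1 - α) := fun x => by
    have h := abs_le.1 (hr2 x)
    have : -1 ≤ r x / (1 - α) := by
      rw [le_div_iff₀ hα1]
      linarith
    linarith
  have hfi : Integrable f (stdGaussian (EuclideanSpace ℝ (Fin n))) :=
    Integrable.of_bound hf.aestronglyMeasurable 1 (Filter.Eventually.of_forall hfb)
  have hfe : Integrable (fun x => Real.exp (ρ * ⟪v, x⟫ - ρ ^ 2 / 2) * f x)
      (stdGaussian (EuclideanSpace ℝ (Fin n))) :=
    (integrable_exp_inner hv ρ).mul_bdd hf.aestronglyMeasurable (Filter.Eventually.of_forall hfb)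
  have hri : Integrable (fun x => r ⟪v, x⟫ * f x) (stdGaussian (EuclideanSpace ℝ (Fin n))) :=
    hfi.bdd_mul (c := 1 / 2) (by fun_prop) (Filter.Eventually.of_forall fun x => hr2 _)
  have hbi : Integrable (fun x => (1 + r ⟪v, x⟫ / (1 - α)) * f x)
      (stdGaussian (EuclideanSpace ℝ (Fin n))) := by
    have := hfi.add (hri.div_const (1 - α))
    refine this.congr (Filter.Eventually.of_forall fun x => ?_)
    simp only [Pi.add_apply]
    ring
  have hm1 : Measurable fun x : EuclideanSpace ℝ (Fin n) =>
      ENNReal.ofReal (Real.exp (ρ * ⟪v, x⟫ - ρ ^ 2 / 2)) := by fun_prop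
  have hm2 : Measurable fun x : EuclideanSpace ℝ (Fin n) =>
      ENNReal.ofReal (1 + r ⟪v, x⟫ / (1 - α)) :=
    (Continuous.measurable (by fun_prop)).ennreal_ofReal
  have e1 : ∀ x : EuclideanSpace ℝ (Fin n),
      (ENNReal.ofReal (Real.exp (ρ * ⟪v, x⟫ - ρ ^ 2 / 2))).toReal • f x =
        Real.exp (ρ * ⟪v, x⟫ - ρ ^ 2 / 2) * f x := fun x => by
    rw [ENNReal.toReal_ofReal (Real.exp_pos _).le, smul_eq_mul]
  have e2 : ∀ x : EuclideanSpace ℝ (Fin n),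
      (ENNReal.ofReal (1 + r ⟪v, x⟫ / (1 - α))).toReal • f x =
        (1 + r ⟪v, x⟫ / (1 - α)) * f x := fun x => by
    rw [ENNReal.toReal_ofReal (hpos _), smul_eq_mul]
  have ht1 := (integrable_withDensity_iff_integrable_smul' hm1
    (by simp) (g := f) (μ := stdGaussian (EuclideanSpace ℝ (Fin n)))).2 (by simpa only [e1] using hfe)
  have ht2 := (integrable_withDensity_iff_integrable_smul' hm2
    (by simp) (g := f) (μ := stdGaussian (EuclideanSpace ℝ (Fin n)))).2 (by simpa only [e2] using hbi)
  rw [mixtureDist, multivariateGaussian_smul_one hv,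
    integral_add_measure (ht1.smul_measure ENNReal.ofReal_ne_top)
      (ht2.smul_measure ENNReal.ofReal_ne_top),
    integral_smul_measure, integral_smul_measure,
    integral_withDensity_eq_integral_toReal_smul hm1 (by simp),
    integral_withDensity_eq_integral_toReal_smul hm2 (by simp),
    ENNReal.toReal_ofReal hα.le, ENNReal.toReal_ofReal hα1.le]
  simp only [e1, e2, smul_eq_mul]
  have hψi : Integrable (fun x => f x * (α * (Real.exp (ρ * ⟪v, x⟫ - ρ ^ 2 / 2) - 1) + r ⟪v, x⟫))
      (stdGaussian (EuclideanSpace ℝ (Fin n))) := by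
    refine (((hfe.sub hfi).const_mul α).add hri).congr (Filter.Eventually.of_forall fun x => ?_)
    simp only [Pi.add_apply, Pi.sub_apply]
    ring
  rw [← integral_const_mul, ← integral_const_mul, ← integral_add (hfe.const_mul _)
    (hbi.const_mul _), ← integral_add hfi hψi]
  congr 1
  funext x
  field_simp
  ring

lemma isProbabilityMeasure_withDensity_one_add {α : ℝ} {r : ℝ → ℝ} (hα2 : α < 1 / 2)
    (hr : Continuous r) (hr2 : ∀ x, |r x| ≤ 1 / 2) {v : EuclideanSpace ℝ (Fin n)}
    (hr0 : ∫ x, r ⟪v, x⟫ ∂(stdGaussian (EuclideanSpace ℝ (Fin n))) = 0) :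
    IsProbabilityMeasure ((stdGaussian (EuclideanSpace ℝ (Fin n))).withDensity
        fun x => ENNReal.ofReal (1 + r ⟪v, x⟫ / (1 - α))) := by
  have hα1 : 0 < 1 - α := by linarith
  have hpos : ∀ x, 0 ≤ 1 + r x / (1 - α) := fun x => by
    have h := abs_le.1 (hr2 x)
    have : -1 ≤ r x / (1 - α) := by
      rw [le_div_iff₀ hα1]
      linarith
    linarith
  have hri : Integrable (fun x => r ⟪v, x⟫) (stdGaussian (EuclideanSpace ℝ (Fin n))) :=
    Integrable.of_bound (by fun_prop) (1 / 2) (Filter.Eventually.of_forall fun x => hr2 _)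
  constructor
  rw [withDensity_apply _ MeasurableSet.univ, Measure.restrict_univ]
  have hi : Integrable (fun x => 1 + r ⟪v, x⟫ / (1 - α))
      (stdGaussian (EuclideanSpace ℝ (Fin n))) := (integrable_const _).add (hri.div_const _)
  rw [← ofReal_integral_eq_lintegral_ofReal hi (Filter.Eventually.of_forall fun x => hpos _),
    integral_add (integrable_const _) (hri.div_const _), integral_div, hr0]
  simp

/-- With `e` the exponential, `(α e + (r - α))² ≤ 2 α² e² + 2 (r - α)² ≤ e² / 2 + 2`, and `e²` has
mean `exp (ρ²)`. -/
lemma integral_sq_signal_le {α ρ : ℝ} {r : ℝ → ℝ} (hα : 0 < α) (hα2 : α < 1 / 2)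
    (hr2 : ∀ x, |r x| ≤ 1 / 2) {v : EuclideanSpace ℝ (Fin n)} (hv : ‖v‖ = 1)
    {ψ : ℝ → ℝ} (hψ : ∀ x, ψ x = α * (Real.exp (ρ * x - ρ ^ 2 / 2) - 1) + r x)
    (hψi : Integrable (fun x => ψ ⟪v, x⟫ * ψ ⟪v, x⟫) (stdGaussian (EuclideanSpace ℝ (Fin n)))) :
    ∫ x, ψ ⟪v, x⟫ * ψ ⟪v, x⟫ ∂(stdGaussian (EuclideanSpace ℝ (Fin n))) ≤
      3 * Real.exp (ρ ^ 2) := by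
  obtain ⟨h1, h2⟩ := hermiteExp_mul_hermiteExp hv hv ρ ρ
  simp only [hermiteExp_ofReal, ← Complex.ofReal_mul] at h1 h2
  rw [integral_complex_ofReal, real_inner_self_eq_norm_sq, hv] at h2
  have h2' : ∫ x, Real.exp (ρ * ⟪v, x⟫ - ρ ^ 2 / 2) * Real.exp (ρ * ⟪v, x⟫ - ρ ^ 2 / 2)
      ∂(stdGaussian (EuclideanSpace ℝ (Fin n))) = Real.exp (ρ ^ 2) := by
    rw [← Complex.ofReal_exp] at h2
    have := Complex.ofReal_injective h2
    rw [this]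
    ring_nf
  have h1' : Integrable (fun x => Real.exp (ρ * ⟪v, x⟫ - ρ ^ 2 / 2) *
      Real.exp (ρ * ⟪v, x⟫ - ρ ^ 2 / 2)) (stdGaussian (EuclideanSpace ℝ (Fin n))) := h1.re
  calc _ ≤ ∫ x, (1 / 2 * (Real.exp (ρ * ⟪v, x⟫ - ρ ^ 2 / 2) *
          Real.exp (ρ * ⟪v, x⟫ - ρ ^ 2 / 2)) + 2) ∂(stdGaussian (EuclideanSpace ℝ (Fin n))) := by
        refine integral_mono hψi ((h1'.const_mul _).add (integrable_const _)) fun x => ?_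
        simp only [hψ]
        set e := Real.exp (ρ * ⟪v, x⟫ - ρ ^ 2 / 2)
        have hr := abs_le.1 (hr2 ⟪v, x⟫)
        have hs : (r ⟪v, x⟫ - α) ^ 2 ≤ 1 := by
          rw [sq_le_one_iff_abs_le_one, abs_le]
          constructor <;> linarith
        have hα4 : α ^ 2 ≤ 1 / 4 := by nlinarith
        have he : α ^ 2 * e ^ 2 ≤ 1 / 4 * e ^ 2 := mul_le_mul_of_nonneg_right hα4 (sq_nonneg e)
        nlinarith [sq_nonneg (α * e - (r ⟪v, x⟫ - α))]
    _ = 1 / 2 * Real.exp (ρ ^ 2) + 2 := by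
        rw [integral_add (h1'.const_mul _) (integrable_const _), integral_const_mul, h2']
        simp
    _ ≤ 3 * Real.exp (ρ ^ 2) := by
        have : 1 ≤ Real.exp (ρ ^ 2) := Real.one_le_exp (sq_nonneg _)
        linarith

/-- Alternatives hiding a signal in direction `v`, whose densities relative to `N(0, Iₙ)` are
nearly uncorrelated for nearly orthogonal directions. -/
lemma exists_hidden_direction (t : ℕ) : ∃ c₀ > (0 : ℝ), c₀ ≤ 1 ∧
    ∀ c α ρ : ℝ, 0 < c → c ≤ c₀ → 0 < α → α < 1 / 2 →
      ρ = c * ((t : ℝ) * α) ^ (-(1 / (t : ℝ))) → ∀ n k : ℕ,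
      ∃ (D : EuclideanSpace ℝ (Fin n) → Measure (EuclideanSpace ℝ (Fin n)))
        (g : EuclideanSpace ℝ (Fin n) → EuclideanSpace ℝ (Fin n) → ℝ),
        ∀ v, ‖v‖ = 1 → (IsSparse k v → D v ∈ altDists n k α ρ) ∧
          MemLp (g v) 2 (nullDist n) ∧
          (∀ f : EuclideanSpace ℝ (Fin n) → ℝ, Measurable f → (∀ x, f x ∈ Set.Icc (-1 : ℝ) 1) →
            ∫ x, f x ∂(D v) = ∫ x, f x ∂(nullDist n) + ∫ x, f x * g v x ∂(nullDist n)) ∧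
          ∀ u, ‖u‖ = 1 → |∫ x, g v x * g u x ∂(nullDist n)| ≤
            |⟪v, u⟫| ^ (t + 1) * (3 * Real.exp (ρ ^ 2)) := by
  obtain ⟨c₀, h0, h1, hc₀⟩ := exists_moment_matching t
  refine ⟨c₀, h0, h1, fun c α ρ hc hcc hα hα2 hρ n k => ?_⟩
  obtain ⟨r, hr, hr2, h⟩ := hc₀ c α hc hcc hα (by linarith)
  obtain ⟨ψ, hψ⟩ : ∃ ψ : ℝ → ℝ, ∀ x, ψ x = α * (Real.exp (ρ * x - ρ ^ 2 / 2) - 1) + r x :=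
    ⟨_, fun _ => rfl⟩
  have hψc : Continuous ψ := by
    rw [funext hψ]
    fun_prop
  simp only [nullDist, multivariateGaussian_zero_one]
  refine ⟨fun v => mixtureDist α ρ v ((stdGaussian (EuclideanSpace ℝ (Fin n))).withDensity
    fun x => ENNReal.ofReal (1 + r ⟪v, x⟫ / (1 - α))), fun v x => ψ ⟪v, x⟫, fun v hv => ?_⟩
  obtain ⟨hr0, hcorr⟩ := h ρ hρ ψ hψ n v hv
  refine ⟨fun hs => ⟨v, _, hv, hs, isProbabilityMeasure_withDensity_one_add hα2 hr hr2 hr0, rfl⟩,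
    ?_, fun f hf hf1 => ?_, fun u hu => (hcorr u hu).2.trans ?_⟩
  · rw [memLp_two_iff_integrable_sq (by fun_prop)]
    simpa only [sq] using (hcorr v hv).1
  · simp only [hψ]
    exact integral_mixtureDist hα hα2 hr hr2 hv hf hf1
  · exact mul_le_mul_of_nonneg_left (integral_sq_signal_le hα hα2 hr2 hv hψ (hcorr v hv).1)
      (by positivity)

end HiddenDirection

/-! ### Bounded queries against nearly uncorrelated families -/

section Distinguishing

variable {X J : Type*} [MeasurableSpace X] {μ : Measure X} [IsProbabilityMeasure μ]

/-- Cauchy–Schwarz, obtained by integrating `(m - f G)² ≥ 0` with `m` the mean of `f G`. -/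
lemma sq_integral_mul_le {f G : X → ℝ} (hf : AEStronglyMeasurable f μ) (hf1 : ∀ x, |f x| ≤ 1)
    (hG : MemLp G 2 μ) : (∫ x, f x * G x ∂μ) ^ 2 ≤ ∫ x, G x * G x ∂μ := by
  have hGi : Integrable (fun x => G x * G x) μ := hG.integrable_mul hG
  have hfG : Integrable (fun x => f x * G x) μ :=
    (hG.integrable (by norm_num)).bdd_mul hf (Filter.Eventually.of_forall hf1)
  set m := ∫ x, f x * G x ∂μ
  have h : ∫ x, 2 * m * (f x * G x) - m ^ 2 ∂μ ≤ ∫ x, G x * G x ∂μ := by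
    refine integral_mono ((hfG.const_mul _).sub (integrable_const _)) hGi fun x => ?_
    have h1 : f x ^ 2 ≤ 1 := (sq_le_one_iff_abs_le_one _).2 (hf1 x)
    have h2 : f x ^ 2 * G x ^ 2 ≤ 1 * G x ^ 2 := mul_le_mul_of_nonneg_right h1 (sq_nonneg _)
    simp only
    nlinarith [sq_nonneg (m - f x * G x)]
  rw [integral_sub (hfG.const_mul _) (integrable_const _), integral_const_mul] at h
  simp only [integral_const, probReal_univ, smul_eq_mul] at h
  change 2 * m * m - _ ≤ _ at h
  linarith [h, sq m]

/-- A bounded query correlates with few members of a nearly uncorrelated family. -/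
lemma card_mul_le_of_correlated [DecidableEq J] {g : J → X → ℝ} (hg : ∀ j, MemLp (g j) 2 μ)
    {β γ τ : ℝ} (hβ0 : 0 ≤ β) (hβ : ∀ j, ∫ x, g j x * g j x ∂μ ≤ β) (hγ0 : 0 ≤ γ)
    (hγ : ∀ i j, i ≠ j → ∫ x, g i x * g j x ∂μ ≤ γ) (hτ0 : 0 ≤ τ) (hτ : 2 * γ ≤ τ ^ 2)
    {f : X → ℝ} (hf : AEStronglyMeasurable f μ) (hf1 : ∀ x, |f x| ≤ 1) (T : Finset J)
    (hT : ∀ j ∈ T, τ ≤ ∫ x, f x * g j x ∂μ) : (T.card : ℝ) * γ ≤ β := by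
  rcases T.eq_empty_or_nonempty with rfl | hne
  · simpa using hβ0
  have hcard : (0 : ℝ) < T.card := by exact_mod_cast hne.card_pos
  have hGm : MemLp (fun x => ∑ j ∈ T, g j x) 2 μ := memLp_finsetSum _ fun j _ => hg j
  have hlow : (T.card : ℝ) * τ ≤ ∫ x, f x * ∑ j ∈ T, g j x ∂μ := by
    simp only [Finset.mul_sum]
    rw [integral_finsetSum _ fun j _ => ((hg j).integrable (by norm_num)).bdd_mul hf
      (Filter.Eventually.of_forall hf1), ← nsmul_eq_mul]
    exact Finset.card_nsmul_le_sum _ _ _ hT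
  have hup : ∫ x, (∑ j ∈ T, g j x) * ∑ j ∈ T, g j x ∂μ ≤
      (T.card : ℝ) * β + (T.card : ℝ) * (T.card * γ) := by
    simp only [Finset.sum_mul_sum]
    have hi : ∀ i j, Integrable (fun x => g i x * g j x) μ := fun i j =>
      (hg i).integrable_mul (hg j)
    rw [integral_finsetSum _ fun i _ => integrable_finsetSum _ fun j _ => hi i j, ← mul_add,
      ← nsmul_eq_mul]
    refine Finset.sum_le_card_nsmul _ _ _ fun i hiT => ?_
    rw [integral_finsetSum _ fun j _ => hi i j, ← Finset.add_sum_erase _ _ hiT]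
    refine add_le_add (hβ i) ?_
    calc _ ≤ (T.erase i).card • γ := Finset.sum_le_card_nsmul _ _ _ fun j hj =>
          hγ i j (Finset.ne_of_mem_erase hj).symm
      _ ≤ T.card * γ := by
          rw [nsmul_eq_mul]
          exact mul_le_mul_of_nonneg_right (by exact_mod_cast Finset.card_erase_le) hγ0
  have hsq := (sq_integral_mul_le hf hf1 hGm).trans hup
  have h1 : ((T.card : ℝ) * τ) ^ 2 ≤ (T.card : ℝ) * β + (T.card : ℝ) * (T.card * γ) :=
    (pow_le_pow_left₀ (by positivity) hlow 2).trans hsq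
  have h2 : (T.card : ℝ) * (T.card * (2 * γ)) ≤ T.card * (T.card * τ ^ 2) := by gcongr
  -- Since `τ² ≥ 2 γ`, the off-diagonal terms absorb at most half of the left-hand side.
  have h3 : (T.card : ℝ) * (T.card * γ) ≤ T.card * β := by nlinarith
  exact le_of_mul_le_mul_left h3 hcard

end Distinguishing

/-! ### Nearly orthogonal sparse vectors from Reed–Solomon codes -/

section SparseCode

variable {n : ℕ}

/-- The normalized indicator vector of the range of `e`. -/
noncomputable def indicatorVector {l : ℕ} (e : Fin l → Fin n) : EuclideanSpace ℝ (Fin n) :=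
  (1 / √(l : ℝ)) • ∑ i, EuclideanSpace.single (e i) (1 : ℝ)

lemma inner_indicatorVector {l : ℕ} (e e' : Fin l → Fin n) :
    ⟪indicatorVector e, indicatorVector e'⟫ =
      (1 / (l : ℝ)) * ∑ i, ∑ j, if e i = e' j then (1 : ℝ) else 0 := by
  have h : (1 / √(l : ℝ)) * (1 / √(l : ℝ)) = 1 / (l : ℝ) := by
    rw [div_mul_div_comm, Real.mul_self_sqrt (Nat.cast_nonneg _), one_mul]
  rw [indicatorVector, indicatorVector, real_inner_smul_left, real_inner_smul_right, ← mul_assoc, h]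
  simp only [sum_inner, inner_sum, EuclideanSpace.inner_single_left, PiLp.single_apply, map_one,
    one_mul]
  rw [Finset.sum_comm]

lemma isSparse_indicatorVector {l k : ℕ} (hlk : l ≤ k) (e : Fin l → Fin n) :
    IsSparse k (indicatorVector e) := by
  have hsub : {i : Fin n | indicatorVector e i ≠ 0} ⊆ Set.range e := by
    intro i hi
    by_contra hne
    apply hi
    simp only [indicatorVector, PiLp.smul_apply, WithLp.ofLp_sum, Finset.sum_apply]
    rw [Finset.sum_eq_zero, smul_zero]
    intro j _
    rw [PiLp.single_apply, if_neg]
    rintro rfl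
    exact hne ⟨j, rfl⟩
  calc _ ≤ (Set.range e).ncard := Set.ncard_le_ncard hsub
    _ ≤ l := by
      rw [← Set.image_univ]
      exact (Set.ncard_image_le).trans (by simp)
    _ ≤ k := hlk

/-- The graphs of the polynomials of degree less than `d` over `ZMod q`, on `l` points. -/
lemma exists_reedSolomon {l q d : ℕ} (hq : q.Prime) (hl : 1 ≤ l) (hlq : l ≤ q) (hn : l * q ≤ n) :
    ∃ v : Fin (q ^ d) → EuclideanSpace ℝ (Fin n),
      (∀ a, ‖v a‖ = 1 ∧ IsSparse l (v a)) ∧ ∀ a b, a ≠ b → |⟪v a, v b⟫| ≤ ((d : ℝ) - 1) / l := by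
  have : Fact q.Prime := ⟨hq⟩
  have hl0 : (0 : ℝ) < l := by exact_mod_cast hl
  have hcard : Fintype.card (Fin l × ZMod q) ≤ Fintype.card (Fin n) := by simpa [ZMod.card] using hn
  obtain ⟨emb⟩ := Function.Embedding.nonempty_of_card_le hcard
  have hcard2 : Fintype.card (Fin (q ^ d)) = Fintype.card (Fin d → ZMod q) := by simp [ZMod.card]
  let code : Fin (q ^ d) ≃ Polynomial.degreeLT (ZMod q) d :=
    (Fintype.equivOfCardEq hcard2).trans (Polynomial.degreeLTEquiv (ZMod q) d).symm.toEquiv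
  let p : Fin (q ^ d) → Polynomial (ZMod q) := fun a => (code a : Polynomial (ZMod q))
  let e : Fin (q ^ d) → Fin l → Fin n := fun a i => emb (i, (p a).eval ((i : ℕ) : ZMod q))
  have hinner : ∀ a b, ⟪indicatorVector (e a), indicatorVector (e b)⟫ =
      (1 / (l : ℝ)) * ((Finset.univ.filter fun i : Fin l =>
        (p a).eval ((i : ℕ) : ZMod q) = (p b).eval ((i : ℕ) : ZMod q)).card : ℝ) := by
    intro a b
    rw [inner_indicatorVector, Finset.card_filter]
    push_cast
    congr 1
    refine Finset.sum_congr rfl fun i _ => ?_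
    rw [Finset.sum_eq_single i]
    · simp [e]
    · intro j _ hj
      simp [e, hj.symm]
    · simp
  refine ⟨fun a => indicatorVector (e a), fun a => ⟨?_, isSparse_indicatorVector le_rfl _⟩,
    fun a b hab => ?_⟩
  · have h := hinner a a
    rw [real_inner_self_eq_norm_sq] at h
    simp only [Finset.filter_true, Finset.card_univ, Fintype.card_fin] at h
    rw [one_div_mul_cancel hl0.ne'] at h
    exact (pow_eq_one_iff_of_nonneg (norm_nonneg _) two_ne_zero).1 h
  · rw [hinner, abs_of_nonneg (by positivity), one_div_mul_eq_div]
    refine div_le_div_of_nonneg_right ?_ hl0.le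
    have hne : p a - p b ≠ 0 := by
      rw [sub_ne_zero]
      exact fun h => hab (code.injective (Subtype.ext h))
    have hdeg : (p a - p b).natDegree < d := by
      rw [Polynomial.natDegree_lt_iff_degree_lt hne, ← Polynomial.mem_degreeLT]
      exact Submodule.sub_mem _ (code a).2 (code b).2
    -- Agreements are roots of the nonzero difference; `l ≤ q` keeps the evaluation points distinct
    -- modulo `q`.
    have hle : (Finset.univ.filter fun i : Fin l =>
        (p a).eval ((i : ℕ) : ZMod q) = (p b).eval ((i : ℕ) : ZMod q)).card ≤
        (p a - p b).natDegree := by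
      rw [← Finset.card_image_of_injective (f := fun i : Fin l => ((i : ℕ) : ZMod q))]
      · refine Polynomial.card_le_degree_of_subset_roots ?_
        intro y hy
        rw [Finset.mem_val, Finset.mem_image] at hy
        obtain ⟨i, hi, rfl⟩ := hy
        rw [Polynomial.mem_roots hne, Polynomial.IsRoot, Polynomial.eval_sub, sub_eq_zero]
        exact (Finset.mem_filter.1 hi).2
      · intro i j hij
        have := (ZMod.natCast_eq_natCast_iff' _ _ _).1 hij
        rw [Nat.mod_eq_of_lt (i.2.trans_le hlq), Nat.mod_eq_of_lt (j.2.trans_le hlq)] at this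
        exact Fin.ext this
    have : ((Finset.univ.filter fun i : Fin l => (p a).eval ((i : ℕ) : ZMod q) =
        (p b).eval ((i : ℕ) : ZMod q)).card : ℝ) + 1 ≤ d := by exact_mod_cast hle.trans_lt hdeg
    linarith

/-- A large family of nearly orthogonal sparse unit vectors. -/
lemma exists_sparse_family {k n : ℕ} (hk : 1 ≤ k) (hn : 1 ≤ n) (hkn : (k : ℝ) ≤ √n) :
    ∃ (N : ℕ) (v : Fin N → EuclideanSpace ℝ (Fin n)), (n : ℝ) ^ (√(k : ℝ) / 16) ≤ N ∧
      (∀ a, ‖v a‖ = 1 ∧ IsSparse k (v a)) ∧ ∀ a b, a ≠ b → |⟪v a, v b⟫| ≤ 2 / √(k : ℝ) := by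
  have hk0 : (0 : ℝ) < k := by exact_mod_cast hk
  rcases hk.eq_or_lt with rfl | hk2
  -- For `k = 1` the allowed inner product is `2`, so one vector repeated suffices: the family need
  -- not be injective.
  · refine ⟨⌈(n : ℝ) ^ (√((1 : ℕ) : ℝ) / 16)⌉₊, fun _ => indicatorVector (l := 1) fun _ => ⟨0, hn⟩,
      Nat.le_ceil _, ?_⟩
    have h1 : ‖indicatorVector (l := 1) fun _ => (⟨0, hn⟩ : Fin n)‖ = 1 := by
      simp [indicatorVector]
    refine ⟨fun a => ⟨h1, isSparse_indicatorVector le_rfl _⟩, fun a b _ => ?_⟩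
    rw [real_inner_self_eq_norm_sq, h1]
    norm_num
  · obtain ⟨q, hq, hmq, hq2⟩ := Nat.exists_prime_lt_and_le_two_mul (Nat.sqrt n)
      (Nat.sqrt_pos.2 hn).ne'
    have hkm : k ≤ Nat.sqrt n := by
      rw [Nat.le_sqrt']
      have := (Real.le_sqrt' hk0).1 hkn
      exact_mod_cast this
    have hl : 1 ≤ k / 2 := by omega
    have hlq : k / 2 ≤ q := by omega
    have hlqn : k / 2 * q ≤ n := by
      calc k / 2 * q ≤ k / 2 * (2 * Nat.sqrt n) := Nat.mul_le_mul_left _ hq2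
        _ = (k / 2 * 2) * Nat.sqrt n := by ring
        _ ≤ Nat.sqrt n * Nat.sqrt n :=
          Nat.mul_le_mul_right _ ((Nat.div_mul_le_self k 2).trans hkm)
        _ ≤ n := Nat.sqrt_le n
    -- As `q ≥ √n`, this degree gives `q ^ d ≥ n ^ (√k / 16)`; as `d - 1 < √k / 8` and `k / 2 ≥ k /
    -- 3` even after rounding down, inner products stay below `2 / √k`.
    obtain ⟨v, hv, hvv⟩ := exists_reedSolomon (d := ⌈√(k : ℝ) / 8⌉₊) hq hl hlq hlqn
    have hsk : 0 < √(k : ℝ) := Real.sqrt_pos.2 hk0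
    refine ⟨_, v, ?_, fun a => ⟨(hv a).1, (hv a).2.trans (Nat.div_le_self k 2)⟩,
      fun a b hab => (hvv a b hab).trans ?_⟩
    · have hnq : √(n : ℝ) ≤ q := by
        rw [Real.sqrt_le_left (by positivity)]
        have := Nat.sqrt_lt'.1 hmq
        exact_mod_cast this.le
      have hn1 : (1 : ℝ) ≤ √n := by
        rw [Real.one_le_sqrt]
        exact_mod_cast hn
      calc (n : ℝ) ^ (√(k : ℝ) / 16) = √(n : ℝ) ^ (√(k : ℝ) / 8) := by
            rw [Real.sqrt_eq_rpow (n : ℝ), ← Real.rpow_mul (Nat.cast_nonneg n)]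
            congr 1
            ring
        _ ≤ √(n : ℝ) ^ ((⌈√(k : ℝ) / 8⌉₊ : ℕ) : ℝ) :=
            Real.rpow_le_rpow_of_exponent_le hn1 (Nat.le_ceil _)
        _ = √(n : ℝ) ^ ⌈√(k : ℝ) / 8⌉₊ := Real.rpow_natCast _ _
        _ ≤ (q : ℝ) ^ ⌈√(k : ℝ) / 8⌉₊ := pow_le_pow_left₀ (by positivity) hnq _
        _ = ((q ^ ⌈√(k : ℝ) / 8⌉₊ : ℕ) : ℝ) := by push_cast; rfl
    · have h1 : ((⌈√(k : ℝ) / 8⌉₊ : ℕ) : ℝ) < √(k : ℝ) / 8 + 1 := Nat.ceil_lt_add_one (by positivity)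
      have h2 : (k : ℝ) ≤ 3 * ((k / 2 : ℕ) : ℝ) := by
        have : k ≤ 3 * (k / 2) := by omega
        exact_mod_cast this
      have h3 : (0 : ℝ) < ((k / 2 : ℕ) : ℝ) := by exact_mod_cast hl
      have h4 : √(k : ℝ) * √(k : ℝ) = k := Real.mul_self_sqrt hk0.le
      rw [div_le_div_iff₀ h3 hsk]
      nlinarith

end SparseCode

/-! ### Masking oracles and counting over seeds -/

section Oracles

variable {n : ℕ}

/-- The oracle that answers every query by its expectation. -/
noncomputable def exactOracle (D : Measure (EuclideanSpace ℝ (Fin n))) (q : StatQuery n) : ℝ :=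
  ∫ x, q.toFun x ∂D

lemma isStatOracle_exactOracle (D : Measure (EuclideanSpace ℝ (Fin n))) :
    IsStatOracle D (exactOracle D) := fun q => by
  simpa [exactOracle] using q.tol_pos.le

open Classical in
/-- The oracle for `D` that answers as if the distribution were `D₀` whenever it may. -/
noncomputable def maskingOracle (D₀ D : Measure (EuclideanSpace ℝ (Fin n))) (q : StatQuery n) : ℝ :=
  if |exactOracle D₀ q - exactOracle D q| ≤ q.tol then exactOracle D₀ q else exactOracle D q

lemma isStatOracle_maskingOracle (D₀ D : Measure (EuclideanSpace ℝ (Fin n))) :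
    IsStatOracle D (maskingOracle D₀ D) := fun q => by
  rw [maskingOracle]
  split_ifs with h
  · exact h
  · exact isStatOracle_exactOracle D q

/-- Agreement along the path taken under `O` forces the same path under `O'`. -/
lemma SQAlgorithm.verdict_congr {O O' : StatQuery n → ℝ} (A : SQAlgorithm n)
    (h : ∀ q ∈ A.queries O, O' q = O q) : A.verdict O' = A.verdict O := by
  induction A with
  | output b => rfl
  | ask q next ih =>
    rw [SQAlgorithm.queries, List.forall_mem_cons] at h
    rw [SQAlgorithm.verdict, SQAlgorithm.verdict, h.1]
    exact ih _ h.2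

open Classical in
lemma card_filter_exists_mem_le {J Q : Type*} [Fintype J] (r : Q → J → Prop) {R : ℝ} (l : List Q)
    (h : ∀ q ∈ l, ((Finset.univ.filter fun j => r q j).card : ℝ) ≤ R) :
    ((Finset.univ.filter fun j => ∃ q ∈ l, r q j).card : ℝ) ≤ l.length * R := by
  induction l with
  | nil => simp
  | cons a l ih =>
    rw [List.forall_mem_cons] at h
    have h1 : (Finset.univ.filter fun j => ∃ q ∈ a :: l, r q j).card ≤
        (Finset.univ.filter fun j => r a j).card +
          (Finset.univ.filter fun j => ∃ q ∈ l, r q j).card := by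
      simp only [List.exists_mem_cons_iff, Finset.filter_or]
      exact Finset.card_union_le _ _
    have h2 : ((Finset.univ.filter fun j => ∃ q ∈ a :: l, r q j).card : ℝ) ≤
        ((Finset.univ.filter fun j => r a j).card : ℝ) +
          ((Finset.univ.filter fun j => ∃ q ∈ l, r q j).card : ℝ) := by exact_mod_cast h1
    rw [List.length_cons]
    push_cast
    linarith [h.1, ih h.2]

open Classical in
/-- If no query of tolerance more than `τ` tells `D₀` from more than `R` of the `D j`, then few
such queries do not suffice for testing `D₀` against the `D j`. -/
lemma card_div_three_le_of_solves {Ω J : Type*} [MeasurableSpace Ω] [Fintype J] {P : Measure Ω}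
    [IsProbabilityMeasure P] {A : Ω → SQAlgorithm n} {D₀ : Measure (EuclideanSpace ℝ (Fin n))}
    {D : J → Measure (EuclideanSpace ℝ (Fin n))} {τ R L : ℝ} (hR : 0 ≤ R) (hL : 0 ≤ L)
    (h₀ : P {ω | (A ω).verdict (exactOracle D₀) ≠ false} ≤ 1 / 3)
    (hD : ∀ j, P {ω | (A ω).verdict (maskingOracle D₀ (D j)) ≠ true} ≤ 1 / 3)
    (hcount : ∀ q : StatQuery n, τ < q.tol → ((Finset.univ.filter fun j =>
      q.tol < |exactOracle D₀ q - exactOracle (D j) q|).card : ℝ) ≤ R)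
    (htol : P {ω | ∃ q ∈ (A ω).queries (exactOracle D₀), q.tol ≤ τ} = 0)
    (hlen : P {ω | L ≤ (((A ω).queries (exactOracle D₀)).length : ℝ)} = 0) :
    (Fintype.card J : ℝ) / 3 ≤ L * R := by
  set W₀ := {ω | (A ω).verdict (exactOracle D₀) ≠ false} with hW₀
  set W : J → Set Ω := fun j => {ω | (A ω).verdict (maskingOracle D₀ (D j)) ≠ true} with hW
  set Z := {ω | ∃ q ∈ (A ω).queries (exactOracle D₀), q.tol ≤ τ} ∪
    {ω | L ≤ (((A ω).queries (exactOracle D₀)).length : ℝ)} with hZ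
  have hZ0 : P Z = 0 := measure_union_null htol hlen
  -- The events need not be measurable, so they are replaced by measurable hulls of the same
  -- measure. The complement of `U j` keeps probability at least `1 - 1/3 - 1/3`.
  set U : J → Set Ω := fun j => toMeasurable P W₀ ∪ toMeasurable P (W j) ∪ toMeasurable P Z with hU
  have hUm : ∀ j, MeasurableSet (U j) := fun j =>
    ((measurableSet_toMeasurable _ _).union (measurableSet_toMeasurable _ _)).union
      (measurableSet_toMeasurable _ _)
  have hthird : ∀ s : Set Ω, P s ≤ 1 / 3 → P.real (toMeasurable P s) ≤ 1 / 3 := fun s hs => by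
    rw [Measure.real, measure_toMeasurable]
    simpa using ENNReal.toReal_mono (by simp) hs
  have hUP : ∀ j, 1 / 3 ≤ P.real (U j)ᶜ := fun j => by
    rw [probReal_compl_eq_one_sub (hUm j)]
    have h1 := measureReal_union_le (μ := P) (toMeasurable P W₀ ∪ toMeasurable P (W j))
      (toMeasurable P Z)
    have h2 := measureReal_union_le (μ := P) (toMeasurable P W₀) (toMeasurable P (W j))
    have h3 : P.real (toMeasurable P Z) = 0 := by
      rw [Measure.real, measure_toMeasurable, hZ0, ENNReal.toReal_zero]
    have h4 := hthird _ h₀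
    have h5 := hthird _ (hD j)
    change 1 / 3 ≤ 1 - P.real (toMeasurable P W₀ ∪ toMeasurable P (W j) ∪ toMeasurable P Z)
    linarith
  -- For a good seed the verdicts under the null and under `D j` differ, so some query on the null
  -- path separates them; a union bound over that path counts such `j`.
  have hpoint : ∀ ω, ∑ j, (U j)ᶜ.indicator (1 : Ω → ℝ) ω ≤ L * R := by
    intro ω
    by_cases hω : ω ∈ toMeasurable P Z
    · rw [Finset.sum_eq_zero]
      · positivity
      · intro j _
        have hmem : ω ∈ U j := Or.inr hω
        simp [hmem]
    · have hωZ : ω ∉ Z := fun h => hω (subset_toMeasurable _ _ h)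
      simp only [hZ, Set.mem_union, Set.mem_ofPred_eq, not_or, not_exists, not_and, not_le] at hωZ
      have hsub : (Finset.univ.filter fun j => ω ∈ (U j)ᶜ) ⊆
          Finset.univ.filter fun j => ∃ q ∈ (A ω).queries (exactOracle D₀),
            q.tol < |exactOracle D₀ q - exactOracle (D j) q| := by
        intro j hj
        rw [Finset.mem_filter] at hj ⊢
        refine ⟨Finset.mem_univ _, ?_⟩
        by_contra hne
        push Not at hne
        have hv : (A ω).verdict (maskingOracle D₀ (D j)) = (A ω).verdict (exactOracle D₀) :=
          SQAlgorithm.verdict_congr _ fun q hq => if_pos (hne q hq)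
        have hn0 : ω ∉ W₀ := fun h => hj.2 (Or.inl (Or.inl (subset_toMeasurable _ _ h)))
        have hnj : ω ∉ W j := fun h => hj.2 (Or.inl (Or.inr (subset_toMeasurable _ _ h)))
        simp only [hW₀, hW, Set.mem_ofPred_eq, not_not] at hn0 hnj
        rw [hn0, hnj] at hv
        exact absurd hv (by decide)
      calc ∑ j, (U j)ᶜ.indicator (1 : Ω → ℝ) ω
          = ((Finset.univ.filter fun j => ω ∈ (U j)ᶜ).card : ℝ) := by
            rw [Finset.card_filter]
            push_cast
            exact Finset.sum_congr rfl fun j _ => by simp [Set.indicator_apply]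
        _ ≤ _ := by exact_mod_cast Finset.card_le_card hsub
        _ ≤ ((A ω).queries (exactOracle D₀)).length * R :=
            card_filter_exists_mem_le _ _ fun q hq => hcount q (hωZ.1 q hq)
        _ ≤ L * R := mul_le_mul_of_nonneg_right hωZ.2.le hR
  have hi : ∀ j ∈ Finset.univ, Integrable ((U j)ᶜ.indicator (1 : Ω → ℝ)) P := fun j _ =>
    (integrable_const (1 : ℝ)).indicator (hUm j).compl
  calc (Fintype.card J : ℝ) / 3 = ∑ _j : J, (1 / 3 : ℝ) := by
        rw [Finset.sum_const, Finset.card_univ, nsmul_eq_mul]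
        ring
    _ ≤ ∑ j, P.real (U j)ᶜ := Finset.sum_le_sum fun j _ => hUP j
    _ = ∫ ω, ∑ j, (U j)ᶜ.indicator (1 : Ω → ℝ) ω ∂P := by
        rw [integral_finsetSum _ hi]
        exact Finset.sum_congr rfl fun j _ => (integral_indicator_one (hUm j).compl).symm
    _ ≤ ∫ _ω, L * R ∂P := integral_mono (integrable_finsetSum _ hi) (integrable_const _) hpoint
    _ = L * R := by simp

end Oracles

/-! ### Constants and conclusion -/

open Classical in
lemma card_filter_lt_abs_integral_le {X J : Type*} [MeasurableSpace X] {μ : Measure X}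
    [IsProbabilityMeasure μ] [Fintype J] {g : J → X → ℝ} (hg : ∀ j, MemLp (g j) 2 μ)
    {β γ τ : ℝ} (hβ0 : 0 ≤ β) (hβ : ∀ j, ∫ x, g j x * g j x ∂μ ≤ β) (hγ0 : 0 < γ)
    (hγ : ∀ i j, i ≠ j → ∫ x, g i x * g j x ∂μ ≤ γ) (hτ0 : 0 ≤ τ) (hτ : 2 * γ ≤ τ ^ 2)
    {f : X → ℝ} (hf : Measurable f) (hf1 : ∀ x, |f x| ≤ 1) :
    ((Finset.univ.filter fun j => τ < |∫ x, f x * g j x ∂μ|).card : ℝ) ≤ 2 * (β / γ) := by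
  have h1 := card_mul_le_of_correlated hg hβ0 hβ hγ0.le hγ hτ0 hτ hf.aestronglyMeasurable hf1
    (Finset.univ.filter fun j => τ < ∫ x, f x * g j x ∂μ)
    (fun j hj => (Finset.mem_filter.1 hj).2.le)
  have h2 := card_mul_le_of_correlated hg hβ0 hβ hγ0.le hγ hτ0 hτ hf.neg.aestronglyMeasurable
    (fun x => by simpa using hf1 x)
    (Finset.univ.filter fun j => τ < -∫ x, f x * g j x ∂μ) (fun j hj => by
      have := (Finset.mem_filter.1 hj).2.le
      simpa [integral_neg] using this)
  rw [← le_div_iff₀ hγ0] at h1 h2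
  have h3 : (Finset.univ.filter fun j => τ < |∫ x, f x * g j x ∂μ|).card ≤
      (Finset.univ.filter fun j => τ < ∫ x, f x * g j x ∂μ).card +
        (Finset.univ.filter fun j => τ < -∫ x, f x * g j x ∂μ).card := by
    simp only [lt_abs, Finset.filter_or]
    exact Finset.card_union_le _ _
  have h4 : ((Finset.univ.filter fun j => τ < |∫ x, f x * g j x ∂μ|).card : ℝ) ≤
      ((Finset.univ.filter fun j => τ < ∫ x, f x * g j x ∂μ).card : ℝ) +
        ((Finset.univ.filter fun j => τ < -∫ x, f x * g j x ∂μ).card : ℝ) := by exact_mod_cast h3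
  linarith

lemma two_div_sqrt_pow (k t : ℕ) :
    (2 / √(k : ℝ)) ^ (t + 1) = 2 ^ (t + 1) * (k : ℝ) ^ (-(((t : ℝ) + 1) / 2)) := by
  rw [div_pow, Real.rpow_neg (Nat.cast_nonneg k), Real.sqrt_eq_rpow, ← Real.rpow_mul_natCast
    (Nat.cast_nonneg k), div_eq_mul_inv]
  congr 3
  push_cast
  ring

/-- The left side carries the factor `2 · 2 · 3 = 12`, below `4² = 16`; `c ≤ 1` gives `ρ² ≤ a ^ (-2
/ t)`. This fixes the constants `4` and `1`. -/
lemma tolerance_bound {t k : ℕ} {c a ρ : ℝ} (hc : 0 < c) (hc1 : c ≤ 1) (ha : 0 < a)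
    (hρ : ρ = c * a ^ (-(1 / (t : ℝ)))) :
    2 * ((2 / √(k : ℝ)) ^ (t + 1) * (3 * Real.exp (ρ ^ 2))) ≤
      (4 * (2 : ℝ) ^ ((t : ℝ) / 2) * (k : ℝ) ^ (-(((t : ℝ) + 1) / 4)) *
        Real.exp (1 * a ^ (-(2 / (t : ℝ))))) ^ 2 := by
  have h2 : ((2 : ℝ) ^ ((t : ℝ) / 2)) ^ 2 = 2 ^ t := by
    rw [← Real.rpow_mul_natCast (by norm_num), ← Real.rpow_natCast]
    congr 1
    push_cast
    ring
  have hk : ((k : ℝ) ^ (-(((t : ℝ) + 1) / 4))) ^ 2 = (k : ℝ) ^ (-(((t : ℝ) + 1) / 2)) := by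
    rw [← Real.rpow_mul_natCast (Nat.cast_nonneg k)]
    congr 1
    push_cast
    ring
  have hρ2 : ρ ^ 2 ≤ a ^ (-(2 / (t : ℝ))) := by
    have : (a ^ (-(1 / (t : ℝ)))) ^ 2 = a ^ (-(2 / (t : ℝ))) := by
      rw [← Real.rpow_mul_natCast ha.le]
      congr 1
      push_cast
      ring
    rw [hρ, mul_pow, this]
    exact mul_le_of_le_one_left (by positivity) (pow_le_one₀ hc.le hc1)
  have hE : Real.exp (ρ ^ 2) ≤ Real.exp (1 * a ^ (-(2 / (t : ℝ)))) ^ 2 := by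
    rw [← Real.exp_nat_mul]
    apply Real.exp_le_exp.2
    have : 0 ≤ a ^ (-(2 / (t : ℝ))) := by positivity
    push_cast
    linarith
  rw [mul_pow, mul_pow, mul_pow, h2, hk, two_div_sqrt_pow, pow_succ 2 t]
  set y := (k : ℝ) ^ (-(((t : ℝ) + 1) / 2))
  set E := Real.exp (1 * a ^ (-(2 / (t : ℝ)))) ^ 2
  have hy : 0 ≤ (2 : ℝ) ^ t * y := by positivity
  have hEE : 0 ≤ 2 ^ t * y * E := by positivity
  calc _ = 12 * (2 ^ t * y * Real.exp (ρ ^ 2)) := by ring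
    _ ≤ 12 * (2 ^ t * y * E) := by gcongr
    _ ≤ 16 * (2 ^ t * y * E) := by linarith
    _ = _ := by ring

theorem theorem4p5 :
    ∃ C₁ > (0 : ℝ), ∃ C₂ > (0 : ℝ), ∃ C₃ > (0 : ℝ),
      ∀ t : ℕ, 1 ≤ t → ∃ c₀ > (0 : ℝ), ∀ c : ℝ, 0 < c → c ≤ c₀ →
      ∀ (k n : ℕ) (α ρ : ℝ), 1 ≤ k → 1 ≤ n → (k : ℝ) ≤ Real.sqrt n →
      0 < α → α < 1 / 2 → ρ = c * ((t : ℝ) * α) ^ (-(1 / (t : ℝ))) →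
      ∀ {Ω : Type*} [MeasurableSpace Ω] (P : Measure Ω) [IsProbabilityMeasure P]
        (A : Ω → SQAlgorithm n), SolvesTesting k α ρ P A →
      ∃ D ∈ insert (nullDist n) (altDists n k α ρ), ∃ O : StatQuery n → ℝ, IsStatOracle D O ∧
        (0 < P {ω | ∃ q ∈ (A ω).queries O,
            q.tol ≤ C₁ * (2 : ℝ) ^ ((t : ℝ) / 2) * (k : ℝ) ^ (-(((t : ℝ) + 1) / 4)) *
              Real.exp (C₂ * ((t : ℝ) * α) ^ (-(2 / (t : ℝ))))} ∨
         0 < P {ω | C₃ * (n : ℝ) ^ (Real.sqrt k / 16) * (k : ℝ) ^ (-(((t : ℝ) + 1) / 2)) ≤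
            (((A ω).queries O).length : ℝ)}) := by
  classical
  refine ⟨4, by norm_num, 1, by norm_num, 1 / 2, by norm_num, fun t ht => ?_⟩
  obtain ⟨c₀, hc₀, hc₀1, hdir⟩ := exists_hidden_direction t
  refine ⟨c₀, hc₀, fun c hc hcc k n α ρ hk hn hkn hα hα2 hρ Ω _ P _ A ⟨hnull, halt⟩ => ?_⟩
  -- The null with exact answers is always a bad instance; the alternatives serve only to force
  -- queries there.
  refine ⟨nullDist n, Set.mem_insert _ _, exactOracle (nullDist n), isStatOracle_exactOracle _, ?_⟩
  by_contra hcon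
  rw [not_or, not_lt, not_lt, nonpos_iff_eq_zero, nonpos_iff_eq_zero] at hcon
  obtain ⟨htol, hlen⟩ := hcon
  obtain ⟨D, g, hDg⟩ := hdir c α ρ hc hcc hα hα2 hρ n k
  obtain ⟨N, v, hN, hv, hvv⟩ := exists_sparse_family hk hn hkn
  have hk0 : (0 : ℝ) < k := by exact_mod_cast hk
  have htα : 0 < (t : ℝ) * α := mul_pos (by exact_mod_cast ht) hα
  set τ := 4 * (2 : ℝ) ^ ((t : ℝ) / 2) * (k : ℝ) ^ (-(((t : ℝ) + 1) / 4)) *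
    Real.exp (1 * ((t : ℝ) * α) ^ (-(2 / (t : ℝ)))) with hτ
  have hτ0 : 0 ≤ τ := by positivity
  set β := 3 * Real.exp (ρ ^ 2) with hβ
  have hβ0 : 0 < β := by positivity
  set γ := (2 / √(k : ℝ)) ^ (t + 1) * β with hγ
  have hγ0 : 0 < γ := by positivity
  have hγτ : 2 * γ ≤ τ ^ 2 := tolerance_bound hc (hcc.trans hc₀1) htα hρ
  have hprob : IsProbabilityMeasure (nullDist n) := by
    rw [nullDist, multivariateGaussian_zero_one]
    infer_instance
  have hcount : ∀ q : StatQuery n, τ < q.tol → ((Finset.univ.filter fun j =>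
      q.tol < |exactOracle (nullDist n) q - exactOracle (D (v j)) q|).card : ℝ) ≤
        2 * (β / γ) := by
    intro q hq
    have h := card_filter_lt_abs_integral_le (μ := nullDist n) (g := fun j => g (v j))
      (fun j => (hDg _ (hv j).1).2.1) hβ0.le (fun j => ?_) hγ0 (fun i j hij => ?_) q.tol_pos.le
      (hγτ.trans (pow_le_pow_left₀ hτ0 hq.le 2)) q.measurable_toFun
      (fun x => abs_le.2 (q.mem_Icc x))
    · have he : ∀ j, |exactOracle (nullDist n) q - exactOracle (D (v j)) q| =
          |∫ x, q.toFun x * g (v j) x ∂(nullDist n)| := fun j => by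
        simp only [exactOracle]
        rw [(hDg _ (hv j).1).2.2.1 _ q.measurable_toFun q.mem_Icc, sub_add_cancel_left, abs_neg]
      simpa only [he] using h
    · have := (le_abs_self _).trans ((hDg _ (hv j).1).2.2.2 _ (hv j).1)
      rw [real_inner_self_eq_norm_sq, (hv j).1] at this
      simpa using this
    · refine ((le_abs_self _).trans ((hDg _ (hv i).1).2.2.2 _ (hv j).1)).trans ?_
      exact mul_le_mul_of_nonneg_right (pow_le_pow_left₀ (abs_nonneg _) (hvv i j hij) _) hβ0.le
  have hfinal := card_div_three_le_of_solves (P := P) (A := A) (D₀ := nullDist n)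
    (D := fun j => D (v j)) (τ := τ) (by positivity) (by positivity)
    (hnull _ (isStatOracle_exactOracle _))
    (fun j => halt _ ((hDg _ (hv j).1).1 (hv j).2) _ (isStatOracle_maskingOracle _ _))
    hcount htol hlen
  rw [Fintype.card_fin, hγ, two_div_sqrt_pow] at hfinal
  have hy : 0 < (k : ℝ) ^ (-(((t : ℝ) + 1) / 2)) := by positivity
  have hn0 : 0 < (n : ℝ) ^ (√(k : ℝ) / 16) := Real.rpow_pos_of_pos (by exact_mod_cast hn) _
  -- Here `t ≥ 1` matters: the count becomes `N / 3 ≤ n ^ (√k / 16) / 4`, contradicting `N ≥ n ^ (√k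
  -- / 16)`.
  have h4 : (4 : ℝ) ≤ 2 ^ (t + 1) :=
    calc (4 : ℝ) = 2 ^ (1 + 1) := by norm_num
      _ ≤ 2 ^ (t + 1) := pow_le_pow_right₀ (by norm_num) (by omega)
  have heq : 1 / 2 * (n : ℝ) ^ (√(k : ℝ) / 16) * (k : ℝ) ^ (-(((t : ℝ) + 1) / 2)) *
      (2 * (β / (2 ^ (t + 1) * (k : ℝ) ^ (-(((t : ℝ) + 1) / 2)) * β))) =
      (n : ℝ) ^ (√(k : ℝ) / 16) / 2 ^ (t + 1) := by
    field_simp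
  rw [heq] at hfinal
  have h5 : (n : ℝ) ^ (√(k : ℝ) / 16) / 2 ^ (t + 1) ≤ (n : ℝ) ^ (√(k : ℝ) / 16) / 4 :=
    div_le_div_of_nonneg_left hn0.le (by norm_num) h4
  linarith
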